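/- **Theorem 3.6.** Let $g^{ij}$ be a symmetric $d\times d$ matrix of polynomials in $\mathbb{C}[x_1,\dots,x_d]$ of degree $\le 2$, let $D=\det(g^{ij})$, and suppose that $g^{ij}$ is *admissible*: $\deg D=2d$ (the maximal possible degree), $D$ has no multiple factors, and $D$ divides $\sum_j g^{ij}\,\partial_j D$ for every $i$. Let $S=\{(x,y)\in\mathbb{C}^d\times\mathbb{C} : y^2=D(x)\}$ be the double covering of $\mathbb{C}^d$ branched in $D=0$, with projection $\pi(x,y)=x$ and involution $(x,y)\mapsto(x,-y)$. A symmetric tensor $h^{ij}$ on $\mathbb{C}^d$ with polynomial components *comes from the double covering* if it is the image under $d\pi$ of a regular symmetric contravariant $2$-tensor field on the smooth part of $S$ which is invariant under the involution. Suppose that $g^{ij}$ is *irreducible*: every such $h^{ij}$ with components of degree $\le 2$ has the form $h^{ij}=c\,g^{ij}$ with a constant $c\in\mathbb{C}$. Let $(g_{ij})$ be the inverse matrix of $(g^{ij})$, and let $R_{kl}$ be the Ricci tensor of the metric $g_{ij}$; its components are rational functions on $\mathbb{C}^d$. Then the contravariant Ricci tensor $R^{ij}=\sum_{k,l}g^{ik}g^{jl}R_{kl}$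 is proportional to $g^{ij}$: there is a constant $\lambda\in\mathbb{C}$ such that $R^{ij}=\lambda\, g^{ij}$ for all $i,j$. -/

import Mathlib

noncomputable section

namespace PolyCometric

/-! ### Partial derivatives of rational functions -/

/-- The field `ℂ(x₁, …, x_d)` of rational functions on `ℂ^d`. -/
abbrev RatFun (d : ℕ) : Type := FractionRing (MvPolynomial (Fin d) ℂ)

/-- The inclusion of polynomials into rational functions. -/
abbrev toRat {d : ℕ} (p : MvPolynomial (Fin d) ℂ) : RatFun d :=
  algebraMap (MvPolynomial (Fin d) ℂ) (RatFun d) p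

/-- The partial derivative `∂f/∂x_i` of a rational function, computed by the quotient rule on the
reduced fraction of `f`; by `ratPderiv_div` any other fraction gives the same value. -/
def ratPderiv {d : ℕ} (i : Fin d) (f : RatFun d) : RatFun d :=
  let a := IsFractionRing.num (MvPolynomial (Fin d) ℂ) f
  let b : MvPolynomial (Fin d) ℂ := IsFractionRing.den (MvPolynomial (Fin d) ℂ) f
  (toRat (MvPolynomial.pderiv i a) * toRat b - toRat a * toRat (MvPolynomial.pderiv i b))
    / toRat b ^ 2

/-- The quotient rule, for an arbitrary representation of a rational function as a fraction. -/
theorem ratPderiv_div {d : ℕ} (i : Fin d) (a b : MvPolynomial (Fin d) ℂ) (hb : b ≠ 0) :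
    ratPderiv i (toRat a / toRat b) =
      (toRat (MvPolynomial.pderiv i a) * toRat b - toRat a * toRat (MvPolynomial.pderiv i b))
        / toRat b ^ 2 := by
  have hinj : Function.Injective (algebraMap (MvPolynomial (Fin d) ℂ) (RatFun d)) :=
    IsFractionRing.injective _ _
  set f : RatFun d := toRat a / toRat b with hf
  set a' := IsFractionRing.num (MvPolynomial (Fin d) ℂ) f with ha'
  set b' : MvPolynomial (Fin d) ℂ :=
    (IsFractionRing.den (MvPolynomial (Fin d) ℂ) f).1 with hb'
  have hb'0 : b' ≠ 0 := nonZeroDivisors.ne_zero (IsFractionRing.den _ f).2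
  have hB : toRat b ≠ 0 := fun h => hb (hinj (by simpa using h))
  have hB' : toRat b' ≠ 0 := fun h => hb'0 (hinj (by simpa using h))
  have hfr : toRat a' / toRat b' = f := IsFractionRing.mk'_num_den' (MvPolynomial (Fin d) ℂ) f
  have h1 : a' * b = a * b' := by
    apply hinj
    rw [hf, div_eq_div_iff hB' hB] at hfr
    simpa using hfr
  have h2 := congrArg (fun p => toRat (MvPolynomial.pderiv i p)) h1
  have h1' := congrArg toRat h1
  simp only [Derivation.leibniz, smul_eq_mul, map_add, map_mul, toRat] at h2 h1'
  change (toRat (MvPolynomial.pderiv i a') * toRat b'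
    - toRat a' * toRat (MvPolynomial.pderiv i b')) / toRat b' ^ 2 = _
  rw [div_eq_div_iff (pow_ne_zero 2 hB') (pow_ne_zero 2 hB)]
  simp only [toRat] at *
  linear_combination
    (algebraMap (MvPolynomial (Fin d) ℂ) (RatFun d) b * algebraMap _ (RatFun d) b') * h2
    - (algebraMap _ (RatFun d) b' * algebraMap _ (RatFun d) (MvPolynomial.pderiv i b)
      + algebraMap _ (RatFun d) b * algebraMap _ (RatFun d) (MvPolynomial.pderiv i b')) * h1'

/-! ### Admissible cometrics and their Ricci tensor -/

/-- A contravariant 2-tensor `g^{ij}` on `ℂ^d` with polynomial components. -/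
abbrev PolyTensor (d : ℕ) : Type := Matrix (Fin d) (Fin d) (MvPolynomial (Fin d) ℂ)

/-- Admissible cometrics: `g^{ij}` is a symmetric tensor with polynomial components of degree at
most `2`, its determinant `D` has the maximal possible degree `2d` and no multiple factors, and
`D` divides `∑ⱼ g^{ij} ∂ⱼD` for every `i`. -/
structure IsAdmissible {d : ℕ} (g : PolyTensor d) : Prop where
  symm : g.IsSymm
  degree_le : ∀ i j, (g i j).totalDegree ≤ 2
  degree_det : g.det.totalDegree = 2 * d
  squarefree_det : Squarefree g.det
  det_dvd : ∀ i, g.det ∣ ∑ j, g i j * MvPolynomial.pderiv j g.det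

section Ricci

variable {d : ℕ} (g : PolyTensor d)

/-- `g^{ij}` as a matrix of rational functions. -/
def cometric : Matrix (Fin d) (Fin d) (RatFun d) := g.map toRat

/-- The metric `g_{ij}`: the inverse matrix of `g^{ij}`. -/
def metric : Matrix (Fin d) (Fin d) (RatFun d) := (cometric g)⁻¹

/-- The Christoffel symbol
`Γ^k_{ij} = ½ ∑ₛ g^{ks} (∂ᵢ g_{js} + ∂ⱼ g_{is} - ∂ₛ g_{ij})`. -/
def christoffel (k i j : Fin d) : RatFun d :=
  1 / 2 * ∑ s, cometric g k s *
    (ratPderiv i (metric g j s) + ratPderiv j (metric g i s) - ratPderiv s (metric g i j))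

/-- The Ricci tensor
`R_{kl} = ∑ₛ (∂ₛ Γ^s_{kl} - ∂ₗ Γ^s_{ks}) + ∑ₛₜ (Γ^s_{st} Γ^t_{kl} - Γ^s_{lt} Γ^t_{ks})`. -/
def ricci (k l : Fin d) : RatFun d :=
  ∑ s, (ratPderiv s (christoffel g s k l) - ratPderiv l (christoffel g s k s))
    + ∑ s, ∑ t, (christoffel g s s t * christoffel g t k l
        - christoffel g s l t * christoffel g t k s)

/-- The contravariant Ricci tensor `R^{ij} = ∑ₖₗ g^{ik} g^{jl} R_{kl}`. -/
def contraRicci (i j : Fin d) : RatFun d :=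
  ∑ k, ∑ l, cometric g i k * cometric g j l * ricci g k l

end Ricci

/-! ### The double covering `S : y² = D(x)`

The ambient space `ℂ^d × ℂ` has its coordinates indexed by `Option (Fin d)`: `some i` is the index
of `x_i` and `none` that of `y`. -/

/-- Points of `ℂ^d × ℂ`. -/
abbrev Pt (d : ℕ) : Type := Option (Fin d) → ℂ

/-- The equation `y² - D(x)` of the double covering. -/
def coverEq {d : ℕ} (D : MvPolynomial (Fin d) ℂ) : MvPolynomial (Option (Fin d)) ℂ :=
  MvPolynomial.X none ^ 2 - MvPolynomial.rename some D

/-- The smooth part of `S = {y² = D(x)}`: the points of `S` where the differential of `y² - D(x)`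
does not vanish. For squarefree `D` this equation is reduced, so that this is the smooth locus
of the variety `S`. -/
def smoothPart {d : ℕ} (D : MvPolynomial (Fin d) ℂ) : Set (Pt d) :=
  {p | MvPolynomial.eval p (coverEq D) = 0 ∧
    ∃ a, MvPolynomial.eval p (MvPolynomial.pderiv a (coverEq D)) ≠ 0}

/-- The projection `π : S → ℂ^d`, `(x, y) ↦ x`. -/
def proj {d : ℕ} (p : Pt d) : Fin d → ℂ := fun i => p (some i)

/-- The covering involution `(x, y) ↦ (x, -y)`. -/
def involution {d : ℕ} (p : Pt d) : Pt d
  | none => -p none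
  | some i => p (some i)

/-- The diagonal entries of the differential of the involution. -/
def involutionSign {d : ℕ} : Option (Fin d) → ℂ
  | none => -1
  | some _ => 1

/-- `f` is a regular function on the quasi-affine variety `U`: locally on `U` it is a quotient of
two polynomials. The values of `f` outside `U` play no role. -/
def IsRegularFunOn {d : ℕ} (U : Set (Pt d)) (f : Pt d → ℂ) : Prop :=
  ∀ p ∈ U, ∃ a b : MvPolynomial (Option (Fin d)) ℂ, MvPolynomial.eval p b ≠ 0 ∧
    ∀ q ∈ U, MvPolynomial.eval q b ≠ 0 → f q = MvPolynomial.eval q a / MvPolynomial.eval q b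

/-- `n` is a regular symmetric contravariant 2-tensor field (a section of `Sym² T`) on the smooth
part of `S`, invariant under the covering involution. At a point `p` of the smooth part it is
given by its components `n^{ab}(p)` in the ambient coordinates, and it lies in
`Sym² T_p S ⊆ Sym² ℂ^{d+1}` exactly when its contraction with the differential of `y² - D(x)`,
whose kernel is `T_p S`, vanishes. -/
structure IsInvariantTensor {d : ℕ} (D : MvPolynomial (Fin d) ℂ)
    (n : Option (Fin d) → Option (Fin d) → Pt d → ℂ) : Prop where
  regular : ∀ a b, IsRegularFunOn (smoothPart D) (n a b)
  symm : ∀ a b, ∀ p ∈ smoothPart D, n a b p = n b a p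
  tangent : ∀ a, ∀ p ∈ smoothPart D,
    ∑ b, n a b p * MvPolynomial.eval p (MvPolynomial.pderiv b (coverEq D)) = 0
  invariant : ∀ a b, ∀ p ∈ smoothPart D,
    n a b (involution p) = involutionSign a * involutionSign b * n a b p

/-- The polynomial tensor `h^{ij}` comes from the double covering `π : S → ℂ^d` branched in
`D = 0`: it is the image under `dπ` of an invariant regular symmetric contravariant 2-tensor field
on the smooth part of `S`. -/
def ComesFromDoubleCover {d : ℕ} (D : MvPolynomial (Fin d) ℂ) (h : PolyTensor d) : Prop :=
  ∃ n : Option (Fin d) → Option (Fin d) → Pt d → ℂ, IsInvariantTensor D n ∧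
    ∀ i j, ∀ p ∈ smoothPart D, n (some i) (some j) p = MvPolynomial.eval (proj p) (h i j)

/-- `g^{ij}` is irreducible if every symmetric polynomial tensor of degree at most `2` which comes
from the double covering branched in `det g = 0` is a constant multiple of `g^{ij}`. -/
def IsIrreducible {d : ℕ} (g : PolyTensor d) : Prop :=
  ∀ h : PolyTensor d, h.IsSymm → (∀ i j, (h i j).totalDegree ≤ 2) →
    ComesFromDoubleCover g.det h → ∃ c : ℂ, h = c • g

end PolyCometric

end

noncomputable section

namespace PolyCometric

open MvPolynomial Matrix

/-! ### Degrees of derivatives and determinants -/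

/-! Irreducibility reduces the claim to three properties of the contravariant Ricci tensor: it is
polynomial, has degree at most 2, and lifts to the double cover.

Denominators disappear because the rows Xᵢ of `g` generate all vector fields logarithmic along D = 0
(`exists_mulVec_eq`). Since deg D is exactly 2d, a logarithmic field of degree at most n + 2 has
coefficients of degree at most n in the Xᵢ. The brackets [Xᵢ, Xⱼ] are logarithmic of degree at most
3, so they equal ∑ cₖXₖ with cₖ of degree at most 1. By the Koszul formula (`sum_mul_levi_civita`)
the connection matrices Aᵢ along Xᵢ are then polynomial of degree at most 1, and the curvature R(Xᵢ,
Xⱼ) is polynomial of degree at most 2. Its skewness with respect to the metric expresses the raised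
Ricci tensor as a plain trace of these matrices (`sum_contraction_eq_neg`).

The same skewness makes D divide the contraction of dD with the upper matrix index of R(Xᵢ, Xⱼ)
(`dvd_sum_of_skew`), so the Ricci tensor is tangent to D = 0. Such a tensor lifts to y² = D by an
explicit formula (`comesFromDoubleCover_of_dvd`). -/

theorem totalDegree_pderiv_le {σ R : Type*} [CommSemiring R] {n : ℕ} (j : σ)
    {p : MvPolynomial σ R} (hp : p.totalDegree ≤ n + 1) : (pderiv j p).totalDegree ≤ n := by
  classical
  refine Finset.sup_le fun m hm => ?_
  rw [mem_support_iff, coeff_pderiv] at hm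
  have h1 := le_totalDegree (mem_support_iff.mpr (left_ne_zero_of_mul hm))
  rw [Finsupp.sum_add_index' (by simp) (by simp)] at h1
  simp only [Finsupp.sum_single_index] at h1
  omega

theorem exists_eq_C_of_pderiv_eq_zero {σ R : Type*} [CommRing R] [IsDomain R] [CharZero R]
    {p : MvPolynomial σ R} (h : ∀ j, pderiv j p = 0) : ∃ c, p = C c := by
  classical
  refine ⟨coeff 0 p, MvPolynomial.ext _ _ fun m => ?_⟩
  rw [coeff_C]
  split_ifs with hm
  · rw [hm]
  · obtain ⟨j, hj⟩ : ∃ j, m j ≠ 0 := by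
      by_contra! hc
      exact hm (Finsupp.ext fun j => (hc j).symm)
    have h1 := coeff_pderiv (i := j) p (m - Finsupp.single j 1)
    have hle : Finsupp.single j 1 ≤ m := by
      simpa [Finsupp.single_le_iff] using Nat.one_le_iff_ne_zero.mpr hj
    rw [h j, coeff_zero, tsub_add_cancel_of_le hle] at h1
    rcases mul_eq_zero.mp h1.symm with h2 | h2
    · exact h2
    · exact absurd h2 (Nat.cast_add_one_ne_zero _)

/-- A derivative has smaller degree, so divisibility forces it to vanish; in characteristic zero `p`
is then constant. -/
theorem isUnit_of_dvd_pderiv {σ K : Type*} [Field K] [CharZero K]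
    {p : MvPolynomial σ K} (hp : p ≠ 0) (h : ∀ j, p ∣ pderiv j p) : IsUnit p := by
  have hz : ∀ j, pderiv j p = 0 := by
    intro j
    by_contra hne
    have h1 := totalDegree_le_of_dvd_of_isDomain (h j) hne
    rcases Nat.eq_zero_or_pos p.totalDegree with h0 | h0
    · rw [totalDegree_eq_zero_iff_eq_C] at h0
      rw [h0, pderiv_C] at hne
      exact hne rfl
    · have := totalDegree_pderiv_le (n := p.totalDegree - 1) j (p := p) (by omega)
      omega
  obtain ⟨c, rfl⟩ := exists_eq_C_of_pderiv_eq_zero hz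
  exact (IsUnit.mk0 c (by rintro rfl; simp at hp)).map C

/-- A squarefree polynomial which divides all products `m ∂ⱼD` divides `m`. -/
theorem dvd_of_dvd_mul_pderiv {σ K : Type*} [Field K] [CharZero K] {D m : MvPolynomial σ K}
    (hD : Squarefree D) (hD0 : D ≠ 0) (h : ∀ j, D ∣ m * pderiv j D) : D ∣ m := by
  obtain ⟨f, m', e, hrel, rfl, rfl⟩ := UniqueFactorizationMonoid.exists_reduced_factors D hD0 m
  have he : e ≠ 0 := left_ne_zero_of_mul hD0
  have hef : IsRelPrime e f := (squarefree_mul_iff.mp hD).1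
  -- Here D = e f and m = e m' with f coprime to m', and to e by squarefreeness. Hence f divides
  -- ∂ⱼ(e f), then e ∂ⱼf, then ∂ⱼf.
  have hf : IsUnit f := by
    refine isUnit_of_dvd_pderiv (right_ne_zero_of_mul hD0) fun j => ?_
    have h1 : f ∣ m' * pderiv j (e * f) := by
      have := h j
      rw [mul_assoc] at this
      exact (mul_dvd_mul_iff_left he).mp this
    have h2 : f ∣ pderiv j (e * f) := hrel.dvd_of_dvd_mul_left h1
    rw [pderiv_mul] at h2
    exact hef.symm.dvd_of_dvd_mul_left ((dvd_add_right (Dvd.intro_left _ rfl)).mp h2)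
  exact mul_dvd_mul_left e (hf.dvd)

theorem totalDegree_det_le {n σ R : Type*} [Fintype n] [DecidableEq n] [CommRing R]
    (M : Matrix n n (MvPolynomial σ R)) (c : n → ℕ) (h : ∀ i j, (M i j).totalDegree ≤ c j) :
    M.det.totalDegree ≤ ∑ j, c j := by
  rw [det_apply]
  refine totalDegree_finsetSum_le fun s _ => (totalDegree_smul_le _ _).trans ?_
  exact (totalDegree_finsetProd _ _).trans (Finset.sum_le_sum fun i _ => h _ _)

/-! ### Logarithmic vector fields -/

/-- A vector field `V` is logarithmic along `D = 0` if `D` divides `V(D)`. -/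
def IsLog {d : ℕ} (D : MvPolynomial (Fin d) ℂ) (V : Fin d → MvPolynomial (Fin d) ℂ) : Prop :=
  D ∣ ∑ j, V j * pderiv j D

section Admissible

variable {d : ℕ} {g : PolyTensor d}

theorem IsAdmissible.det_ne_zero (hg : IsAdmissible g) : g.det ≠ 0 :=
  hg.squarefree_det.ne_zero

theorem IsAdmissible.apply_comm (hg : IsAdmissible g) (i j : Fin d) : g i j = g j i :=
  hg.symm.apply j i

/-- The columns of M, that is, those of `g` with one replaced by V, are all logarithmic, so D
divides Mᵀ dD. Multiplying by the adjugate shows that D divides det M · ∂ⱼD for every j, and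
squarefreeness removes the factor ∂ⱼD. -/
theorem IsAdmissible.dvd_cramer (hg : IsAdmissible g) {V : Fin d → MvPolynomial (Fin d) ℂ}
    (hV : IsLog g.det V) (k : Fin d) : g.det ∣ cramer g V k := by
  rw [cramer_apply]
  set M := g.updateCol k V with hM
  refine dvd_of_dvd_mul_pderiv hg.squarefree_det hg.det_ne_zero fun j => ?_
  let N : Fin d → MvPolynomial (Fin d) ℂ := fun l => pderiv l g.det
  have h1 : ∀ i, g.det ∣ (Mᵀ *ᵥ N) i := by
    intro i
    by_cases hi : i = k
    · subst hi
      simpa [mulVec, dotProduct, hM, N, IsLog] using hV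
    · have := hg.det_dvd i
      simpa [mulVec, dotProduct, hM, N, updateCol_ne hi, hg.apply_comm _ i] using this
  have h2 : M.det * pderiv j g.det = (Mᵀ.adjugate *ᵥ (Mᵀ *ᵥ N)) j := by
    rw [mulVec_mulVec, adjugate_mul, det_transpose, smul_mulVec, one_mulVec]
    rfl
  rw [h2]
  rw [mulVec, dotProduct]
  exact Finset.dvd_sum fun i _ => Dvd.dvd.mul_left (h1 i) _

/-- The rows of `g` generate the module of logarithmic vector fields (Saito's criterion). -/
theorem IsAdmissible.exists_mulVec_eq (hg : IsAdmissible g)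
    {V : Fin d → MvPolynomial (Fin d) ℂ} (hV : IsLog g.det V) :
    ∃ W : Fin d → MvPolynomial (Fin d) ℂ, g *ᵥ W = V ∧
      ∀ n, (∀ l, (V l).totalDegree ≤ n + 2) → ∀ k, (W k).totalDegree ≤ n := by
  choose W hW using hg.dvd_cramer hV
  have hW' : cramer g V = g.det • W := funext hW
  refine ⟨W, ?_, fun n hn k => ?_⟩
  · have h := mulVec_cramer g V
    rw [hW', mulVec_smul] at h
    exact smul_right_injective _ hg.det_ne_zero h
  · by_cases h0 : W k = 0
    · simp [h0]
    -- In the determinant d - 1 columns have degree 2 and the column V has degree n + 2, in total 2d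
    -- + n; division by D removes exactly 2d.
    have h1 : (cramer g V k).totalDegree ≤ 2 * d + n := by
      rw [cramer_apply]
      refine (totalDegree_det_le _ (fun j => 2 + if j = k then n else 0) fun i j => ?_).trans ?_
      · by_cases hj : j = k
        · subst hj
          simpa [add_comm] using hn i
        · simpa [updateCol_ne hj, hj] using hg.degree_le i j
      · simp [Finset.sum_add_distrib, mul_comm]
    rw [hW k, totalDegree_mul_of_isDomain hg.det_ne_zero h0, hg.degree_det] at h1
    omega

/-- The components of the commutator of the vector fields given by rows `i` and `j` of `g`. -/
def bracket (g : PolyTensor d) (i j l : Fin d) : MvPolynomial (Fin d) ℂ :=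
  ∑ s, (g i s * pderiv s (g j l) - g j s * pderiv s (g i l))

/-- The commutator is a derivation that vanishes on the variables. -/
theorem pderiv_comm {σ R : Type*} [CommRing R] (i j : σ) (p : MvPolynomial σ R) :
    pderiv i (pderiv j p) = pderiv j (pderiv i p) := by
  classical
  have h : ⁅pderiv (R := R) i, pderiv (R := R) j⁆ = 0 := by
    refine derivation_ext fun k => ?_
    rw [Derivation.commutator_apply]
    simp only [pderiv_X, Pi.single_apply]
    split_ifs <;> simp
  have := congrArg (fun D => D p) h
  simpa [Derivation.commutator_apply, sub_eq_zero] using this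

/-- With Xᵢ(D) = D aᵢ, the second derivatives of D and the products aᵢaⱼ cancel in the commutator,
leaving [Xᵢ, Xⱼ](D) = D (Xᵢ(aⱼ) - Xⱼ(aᵢ)). -/
theorem IsAdmissible.isLog_bracket (hg : IsAdmissible g) (i j : Fin d) :
    IsLog g.det (bracket g i j) := by
  choose a ha using hg.det_dvd
  have key : ∀ i j, ∑ l, (∑ s, g i s * pderiv s (g j l)) * pderiv l g.det =
      ∑ s, g i s * pderiv s (g.det * a j)
        - ∑ l, ∑ s, g i s * g j l * pderiv s (pderiv l g.det) := by
    intro i j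
    simp only [← ha j, map_sum, Derivation.leibniz, smul_eq_mul, Finset.mul_sum, Finset.sum_mul]
    rw [eq_sub_iff_add_eq, ← Finset.sum_add_distrib]
    simp only [← Finset.sum_add_distrib]
    rw [Finset.sum_comm]
    refine Finset.sum_congr rfl fun s _ => Finset.sum_congr rfl fun l _ => ?_
    ring
  have key2 : ∀ i j, ∑ s, g i s * pderiv s (g.det * a j) =
      g.det * (∑ s, g i s * pderiv s (a j) + a i * a j) := by
    intro i j
    have : g.det * (a i * a j) = (∑ s, g i s * pderiv s g.det) * a j := by rw [ha i]; ring
    rw [mul_add, this]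
    simp only [Derivation.leibniz, smul_eq_mul, Finset.mul_sum, Finset.sum_mul,
      ← Finset.sum_add_distrib]
    refine Finset.sum_congr rfl fun s _ => ?_
    ring
  have hsym : ∑ l, ∑ s, g i s * g j l * pderiv s (pderiv l g.det) =
      ∑ l, ∑ s, g j s * g i l * pderiv s (pderiv l g.det) := by
    rw [Finset.sum_comm]
    refine Finset.sum_congr rfl fun s _ => Finset.sum_congr rfl fun l _ => ?_
    rw [pderiv_comm]; ring
  have : ∑ l, bracket g i j l * pderiv l g.det =
      ∑ l, (∑ s, g i s * pderiv s (g j l)) * pderiv l g.det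
        - ∑ l, (∑ s, g j s * pderiv s (g i l)) * pderiv l g.det := by
    simp only [bracket, Finset.sum_sub_distrib, sub_mul]
  rw [IsLog, this, key i j, key j i, key2, key2, hsym, sub_sub_sub_cancel_right, ← mul_sub]
  exact dvd_mul_right _ _

theorem IsAdmissible.totalDegree_bracket_le (hg : IsAdmissible g) (i j l : Fin d) :
    (bracket g i j l).totalDegree ≤ 1 + 2 := by
  have h : ∀ i j s, (g i s * pderiv s (g j l)).totalDegree ≤ 1 + 2 := fun i j s =>
    (totalDegree_mul _ _).trans <| by
      have h1 := hg.degree_le i s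
      have h2 := totalDegree_pderiv_le (n := 1) s (hg.degree_le j l)
      omega
  exact totalDegree_finsetSum_le fun s _ =>
    (totalDegree_sub _ _).trans (max_le (h i j s) (h j i s))

/-- The structure functions of the Lie algebra of vector fields spanned by the rows of `g`. -/
theorem IsAdmissible.exists_structure (hg : IsAdmissible g) :
    ∃ c : Fin d → Fin d → Fin d → MvPolynomial (Fin d) ℂ,
      (∀ i j l, ∑ k, g l k * c i j k = bracket g i j l) ∧
      ∀ i j k, (c i j k).totalDegree ≤ 1 := by
  choose c hc hdeg using fun i j => hg.exists_mulVec_eq (hg.isLog_bracket i j)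
  exact ⟨c, fun i j l => congrFun (hc i j) l,
    fun i j => hdeg i j 1 (hg.totalDegree_bracket_le i j)⟩

end Admissible

/-! ### Connections and curvature over a commutative ring with commuting derivations -/

/-- The derivation given by an additive map which satisfies the Leibniz rule. -/
def derivationOfLeibniz {K : Type*} [CommRing K] (f : K →+ K)
    (hf : ∀ a b, f (a * b) = a * f b + b * f a) : Derivation ℤ K K :=
  Derivation.mk' f.toIntLinearMap hf

theorem map_derivation_mul {K n : Type*} [CommRing K] [Fintype n] (δ : Derivation ℤ K K)
    (M N : Matrix n n K) : (M * N).map δ = M.map δ * N + M * N.map δ := by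
  ext i j
  simp only [map_apply, mul_apply, Matrix.add_apply, map_sum, Derivation.leibniz, smul_eq_mul,
    ← Finset.sum_add_distrib]
  refine Finset.sum_congr rfl fun k _ => ?_
  ring

section Connection

variable {K n : Type*} [CommRing K] [Fintype n] (δ : n → Derivation ℤ K K)

/-- The curvature `∂ₛωₗ - ∂ₗωₛ + [ωₛ, ωₗ]` of the connection with matrices `ωₛ`. -/
def curvature (ω : n → Matrix n n K) (s l : n) : Matrix n n K :=
  (ω l).map (δ s) - (ω s).map (δ l) + (ω s * ω l - ω l * ω s)

variable {δ}

/-- The curvature of a metric connection is skew with respect to the metric. -/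
theorem curvature_mul_add_mul_transpose {ω : n → Matrix n n K} {γ : Matrix n n K}
    (hδ : ∀ s l x, δ s (δ l x) = δ l (δ s x))
    (hω : ∀ s, γ.map (δ s) = -(ω s * γ + γ * (ω s)ᵀ)) (s l : n) :
    curvature δ ω s l * γ + γ * (curvature δ ω s l)ᵀ = 0 := by
  have hneg : ∀ (s : n) (M : Matrix n n K), (-M).map (δ s) = -(M.map (δ s)) := fun s M => by
    ext; simp
  have hadd : ∀ (s : n) (M N : Matrix n n K), (M + N).map (δ s) = M.map (δ s) + N.map (δ s) :=
    fun s M N => by ext; simp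
  -- Substituting metric compatibility twice into ∂ₛ∂ₗγ = ∂ₗ∂ₛγ gives the claim up to sign.
  have hcomm : (γ.map (δ l)).map (δ s) = (γ.map (δ s)).map (δ l) := by
    ext i j; simp [hδ s l]
  rw [hω l, hω s] at hcomm
  simp only [hneg, hadd, map_derivation_mul, transpose_map, hω] at hcomm
  simp only [curvature, transpose_add, transpose_sub, transpose_mul]
  rw [← sub_eq_zero] at hcomm
  rw [← neg_eq_zero, ← hcomm]
  noncomm_ring

theorem trace_curvature_eq_zero [IsDomain K] [CharZero K] [DecidableEq n] {ω : n → Matrix n n K}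
    {γ G : Matrix n n K} (hδ : ∀ s l x, δ s (δ l x) = δ l (δ s x)) (hG : γ * G = 1)
    (hω : ∀ s, γ.map (δ s) = -(ω s * γ + γ * (ω s)ᵀ)) (s l : n) :
    (curvature δ ω s l).trace = 0 := by
  have h := congrArg (fun M => (M * G).trace) (curvature_mul_add_mul_transpose hδ hω s l)
  simp only [add_mul, trace_add, zero_mul, trace_zero] at h
  rw [mul_assoc, hG, mul_one, trace_mul_comm, ← mul_assoc, mul_eq_one_comm.mp hG, one_mul,
    trace_transpose] at h
  exact add_self_eq_zero.mp h

/-- The commutator in the curvature has trace zero, so tracelessness of the curvature says that the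
1-form tr ω is closed. -/
theorem derivation_trace_comm [IsDomain K] [CharZero K] [DecidableEq n] {ω : n → Matrix n n K}
    {γ G : Matrix n n K} (hδ : ∀ s l x, δ s (δ l x) = δ l (δ s x)) (hG : γ * G = 1)
    (hω : ∀ s, γ.map (δ s) = -(ω s * γ + γ * (ω s)ᵀ)) (s l : n) :
    δ s (ω l).trace = δ l (ω s).trace := by
  have h := trace_curvature_eq_zero hδ hG hω s l
  rw [curvature, trace_add, trace_sub, trace_sub, trace_mul_comm (ω s), sub_self, add_zero,
    sub_eq_zero] at h
  simpa [trace] using h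

/-- The curvature with both form indices raised. -/
theorem sum_smul_curvature {ω : n → Matrix n n K} {γ : Matrix n n K} {A : n → Matrix n n K}
    {c : n → n → n → K} (hA : ∀ i, A i = ∑ s, γ i s • ω s)
    (hc : ∀ i j l, ∑ k, γ l k * c i j k = ∑ s, (γ i s * δ s (γ j l) - γ j s * δ s (γ i l)))
    (hγ : γ.IsSymm) (i j : n) :
    ∑ s, ∑ l, (γ i s * γ j l) • curvature δ ω s l =
      ∑ s, (γ i s • (A j).map (δ s) - γ j s • (A i).map (δ s)) - ∑ k, c i j k • A k
        + (A i * A j - A j * A i) := by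
  have hmul : ∀ i j, A i * A j = ∑ s, ∑ l, (γ i s * γ j l) • (ω s * ω l) := fun i j => by
    simp only [hA, Finset.sum_mul_sum, smul_mul_smul_comm]
  have hmul' : A j * A i = ∑ s, ∑ l, (γ i s * γ j l) • (ω l * ω s) := by
    rw [hmul, Finset.sum_comm]
    simp only [mul_comm]
  have hd : ∀ i j, ∑ s, γ i s • (A j).map (δ s) =
      ∑ s, ∑ l, (γ i s * γ j l) • (ω l).map (δ s)
        + ∑ l, (∑ s, γ i s * δ s (γ j l)) • ω l := by
    intro i j
    ext t k
    simp only [hA, Matrix.sum_apply, Matrix.add_apply, Matrix.smul_apply, map_apply, smul_eq_mul, map_sum,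
      Derivation.leibniz, Finset.sum_mul, Finset.mul_sum]
    rw [Finset.sum_comm (f := fun x y => γ i y * δ y (γ j x) * ω x t k),
      ← Finset.sum_add_distrib]
    refine Finset.sum_congr rfl fun s _ => ?_
    rw [← Finset.sum_add_distrib]
    refine Finset.sum_congr rfl fun l _ => ?_
    ring
  -- This is the connection along [Xᵢ, Xⱼ]; it cancels the terms of `hd` in which a derivative falls
  -- on γ.
  have hcA : ∑ k, c i j k • A k =
      ∑ l, (∑ s, γ i s * δ s (γ j l)) • ω l - ∑ l, (∑ s, γ j s * δ s (γ i l)) • ω l := by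
    have h : ∀ s, ∑ k, c i j k * γ k s = ∑ s', γ i s' * δ s' (γ j s) - ∑ s', γ j s' * δ s' (γ i s) := by
      intro s
      rw [← Finset.sum_sub_distrib, ← hc]
      refine Finset.sum_congr rfl fun k _ => ?_
      rw [hγ.apply s k, mul_comm]
    rw [← Finset.sum_sub_distrib]
    simp only [← sub_smul, ← h]
    simp only [hA, Finset.smul_sum, Finset.sum_smul, smul_smul]
    exact Finset.sum_comm
  have hd' : ∑ s, γ j s • (A i).map (δ s) =
      ∑ s, ∑ l, (γ i s * γ j l) • (ω s).map (δ l)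
        + ∑ l, (∑ s, γ j s * δ s (γ i l)) • ω l := by
    rw [hd, Finset.sum_comm]
    simp only [mul_comm (γ j _) (γ i _)]
  rw [Finset.sum_sub_distrib, hd, hd', hcA, hmul, hmul']
  simp only [curvature, smul_add, smul_sub, Finset.sum_add_distrib, Finset.sum_sub_distrib]
  abel

/-- The twice raised Ricci contraction of a curvature tensor `R` which is skew with respect to the
metric `γ`, in terms of `R` with both form indices raised. -/
theorem sum_contraction_eq_neg {γ : Matrix n n K} {R : n → n → Matrix n n K} (hγ : γ.IsSymm)
    (hR : ∀ s l, R s l * γ + γ * (R s l)ᵀ = 0) (p j : n) :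
    ∑ k, ∑ l, γ p k * γ j l * ∑ s, R s l s k =
      -∑ q, (∑ s, ∑ l, (γ q s * γ j l) • R s l) p q := by
  -- Skewness moves the metric factor from the matrix index k to the form index s, so that both form
  -- indices end up raised.
  have hskew : ∀ s l, ∑ k, γ p k * R s l s k = -∑ q, γ q s * R s l p q := by
    intro s l
    have h := hR s l
    have h' : γ * (R s l)ᵀ = (R s l * γ)ᵀ := by rw [transpose_mul, hγ.eq]
    rw [h'] at h
    have h2 := congrFun (congrFun h s) p
    rw [Matrix.add_apply, transpose_apply, mul_apply, mul_apply, Matrix.zero_apply,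
      add_eq_zero_iff_eq_neg] at h2
    calc _ = ∑ k, R s l s k * γ k p := Finset.sum_congr rfl fun k _ => by
            rw [hγ.apply p k, mul_comm]
      _ = _ := by
            rw [h2]
            simp only [mul_comm]
  have h1 : ∑ k, ∑ l, γ p k * γ j l * ∑ s, R s l s k =
      ∑ l, ∑ s, γ j l * ∑ k, γ p k * R s l s k := by
    simp only [Finset.mul_sum]
    rw [Finset.sum_comm]
    refine Finset.sum_congr rfl fun l _ => ?_
    rw [Finset.sum_comm]
    refine Finset.sum_congr rfl fun s _ => Finset.sum_congr rfl fun k _ => ?_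
    ring
  rw [h1]
  simp only [hskew, mul_neg, Finset.sum_neg_distrib, Finset.mul_sum, Matrix.sum_apply,
    Matrix.smul_apply, smul_eq_mul]
  congr 1
  calc _ = ∑ s, ∑ l, ∑ q, γ j l * (γ q s * R s l p q) := Finset.sum_comm
    _ = ∑ s, ∑ q, ∑ l, γ j l * (γ q s * R s l p q) :=
        Finset.sum_congr rfl fun s _ => Finset.sum_comm
    _ = ∑ q, ∑ s, ∑ l, γ j l * (γ q s * R s l p q) := Finset.sum_comm
    _ = _ := by
        refine Finset.sum_congr rfl fun q _ => Finset.sum_congr rfl fun s _ =>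
          Finset.sum_congr rfl fun l _ => ?_
        ring

theorem sum_smul_mul_add_mul_transpose {γ : Matrix n n K} {R : n → n → Matrix n n K}
    (hR : ∀ s l, R s l * γ + γ * (R s l)ᵀ = 0) (f : n → n → K) :
    (∑ s, ∑ l, f s l • R s l) * γ + γ * (∑ s, ∑ l, f s l • R s l)ᵀ = 0 := by
  simp only [transpose_sum, transpose_smul, Finset.sum_mul, Finset.mul_sum, Matrix.smul_mul,
    Matrix.mul_smul, ← Finset.sum_add_distrib, ← smul_add, hR, smul_zero, Finset.sum_const_zero]

end Connection

/-! ### The Koszul formula for the Levi-Civita connection -/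

section LeviCivita

variable {K n : Type*} [Field K] [Fintype n] [DecidableEq n]
  {δ : n → Derivation ℤ K K} {γ G : Matrix n n K}

theorem sum_derivation_mul_eq_neg (hG : G * γ = 1) (D : Derivation ℤ K K) (i j : n) :
    ∑ r, D (G i r) * γ r j = -∑ r, G i r * D (γ r j) := by
  have h := congrArg (fun M => (M.map D) i j) hG
  simp only [map_derivation_mul] at h
  rw [Matrix.add_apply, mul_apply, mul_apply] at h
  simp only [map_apply] at h
  rw [eq_neg_iff_add_eq_zero, h, one_apply]
  split_ifs <;> simp

/-- Differentiating G γ = 1 moves every derivative from G to γ. Two of the three Christoffel terms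
combine into the bracket of rows i and t of γ, and G survives only as a factor in front of it. -/
theorem sum_mul_levi_civita (hγ : γ.IsSymm) (hGs : G.IsSymm) (hG : G * γ = 1) (i t k : n) :
    ∑ s, γ i s * (1 / 2 * ∑ r, γ t r * (δ s (G k r) + δ k (G s r) - δ r (G s k))) =
      -(1 / 2) * (δ k (γ i t) +
        ∑ c, G k c * ∑ s, (γ i s * δ s (γ t c) - γ t s * δ s (γ i c))) := by
  have h1 : ∑ s, ∑ r, γ i s * γ t r * δ s (G k r) =
      -∑ c, G k c * ∑ s, γ i s * δ s (γ t c) := by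
    have : ∀ s, ∑ r, γ i s * γ t r * δ s (G k r) = -∑ c, G k c * (γ i s * δ s (γ t c)) := by
      intro s
      have h := sum_derivation_mul_eq_neg hG (δ s) k t
      calc _ = γ i s * ∑ r, δ s (G k r) * γ r t := by
            rw [Finset.mul_sum]
            refine Finset.sum_congr rfl fun r _ => ?_
            rw [hγ.apply t r]; ring
        _ = _ := by
            rw [h, mul_neg, Finset.mul_sum]
            congr 1
            refine Finset.sum_congr rfl fun r _ => ?_
            rw [hγ.apply t r]; ring
    simp only [this, Finset.sum_neg_distrib, Finset.mul_sum]
    rw [Finset.sum_comm]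
  have h3 : ∑ s, ∑ r, γ i s * γ t r * δ r (G s k) =
      -∑ c, G k c * ∑ s, γ t s * δ s (γ i c) := by
    have : ∀ r, ∑ s, γ i s * γ t r * δ r (G s k) = -∑ c, G k c * (γ t r * δ r (γ i c)) := by
      intro r
      have h := sum_derivation_mul_eq_neg hG (δ r) k i
      calc _ = γ t r * ∑ s, δ r (G k s) * γ s i := by
            rw [Finset.mul_sum]
            refine Finset.sum_congr rfl fun s _ => ?_
            rw [hγ.apply i s, hGs.apply k s]; ring
        _ = _ := by
            rw [h, mul_neg, Finset.mul_sum]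
            congr 1
            refine Finset.sum_congr rfl fun s _ => ?_
            rw [hγ.apply i s]; ring
    rw [Finset.sum_comm]
    simp only [this, Finset.sum_neg_distrib, Finset.mul_sum]
    rw [Finset.sum_comm]
  have h2 : ∑ s, ∑ r, γ i s * γ t r * δ k (G s r) = -δ k (γ i t) := by
    have : ∀ s, ∑ r, γ i s * γ t r * δ k (G s r) = -∑ r, γ i s * G s r * δ k (γ r t) := by
      intro s
      have h := sum_derivation_mul_eq_neg hG (δ k) s t
      calc _ = γ i s * ∑ r, δ k (G s r) * γ r t := by
            rw [Finset.mul_sum]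
            refine Finset.sum_congr rfl fun r _ => ?_
            rw [hγ.apply t r]; ring
        _ = _ := by
            rw [h, mul_neg, Finset.mul_sum]
            congr 1
            refine Finset.sum_congr rfl fun r _ => ?_
            ring
    simp only [this, Finset.sum_neg_distrib]
    rw [Finset.sum_comm]
    simp only [← Finset.sum_mul, ← mul_apply, mul_eq_one_comm.mp hG]
    simp [one_apply]
  have hexp : ∑ s, γ i s * (1 / 2 * ∑ r, γ t r * (δ s (G k r) + δ k (G s r) - δ r (G s k))) =
      1 / 2 * (∑ s, ∑ r, γ i s * γ t r * δ s (G k r) + ∑ s, ∑ r, γ i s * γ t r * δ k (G s r)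
        - ∑ s, ∑ r, γ i s * γ t r * δ r (G s k)) := by
    simp only [← Finset.sum_add_distrib, ← Finset.sum_sub_distrib, Finset.mul_sum]
    refine Finset.sum_congr rfl fun s _ => Finset.sum_congr rfl fun r _ => ?_
    ring
  rw [hexp, h1, h2, h3]
  simp only [Finset.sum_sub_distrib, mul_sub]
  ring

/-- Levi-Civita connections are metric. -/
theorem map_derivation_eq_neg [CharZero K] (hγ : γ.IsSymm) (hGs : G.IsSymm) (hG : G * γ = 1)
    {ω : n → Matrix n n K}
    (hω : ∀ s t k, ω s t k = 1 / 2 * ∑ r, γ t r * (δ s (G k r) + δ k (G s r) - δ r (G s k)))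
    (s : n) : γ.map (δ s) = -(ω s * γ + γ * (ω s)ᵀ) := by
  -- The bracket term is skew in t and q, so adding the transpose leaves only -∂ₛγ.
  have h : ∀ t q, (ω s * γ) t q = -(1 / 2) * (δ s (γ q t) +
        ∑ c, G s c * ∑ p, (γ q p * δ p (γ t c) - γ t p * δ p (γ q c))) := by
    intro t q
    rw [← sum_mul_levi_civita hγ hGs hG, mul_apply]
    refine Finset.sum_congr rfl fun k _ => ?_
    rw [hγ.apply q k, mul_comm, hω, hGs.apply s k]
    simp only [add_comm]
  have h' : γ * (ω s)ᵀ = (ω s * γ)ᵀ := by rw [transpose_mul, hγ.eq]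
  ext t q
  rw [h', Matrix.neg_apply, Matrix.add_apply, transpose_apply, h, h, map_apply, hγ.apply t q]
  simp only [Finset.sum_sub_distrib, mul_sub]
  ring

end LeviCivita

/-! ### Partial derivatives of rational functions form commuting derivations -/

section RatDeriv

variable {d : ℕ}

theorem toRat_injective : Function.Injective (toRat (d := d)) := IsFractionRing.injective _ _

theorem exists_eq_toRat_div (f : RatFun d) :
    ∃ a b : MvPolynomial (Fin d) ℂ, b ≠ 0 ∧ f = toRat a / toRat b := by
  obtain ⟨a, b, hb, h⟩ := IsFractionRing.div_surjective (A := MvPolynomial (Fin d) ℂ) f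
  exact ⟨a, b, nonZeroDivisors.ne_zero hb, h.symm⟩

theorem toRat_ne_zero {b : MvPolynomial (Fin d) ℂ} (hb : b ≠ 0) : toRat b ≠ 0 :=
  (map_ne_zero_iff _ toRat_injective).mpr hb

theorem ratPderiv_toRat (i : Fin d) (p : MvPolynomial (Fin d) ℂ) :
    ratPderiv i (toRat p) = toRat (pderiv i p) := by
  have h := ratPderiv_div i p 1 one_ne_zero
  simpa using h

theorem ratPderiv_add (i : Fin d) (f h : RatFun d) :
    ratPderiv i (f + h) = ratPderiv i f + ratPderiv i h := by
  obtain ⟨a, b, hb, rfl⟩ := exists_eq_toRat_div f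
  obtain ⟨p, q, hq, rfl⟩ := exists_eq_toRat_div h
  have hB := toRat_ne_zero hb
  have hQ := toRat_ne_zero hq
  have : toRat a / toRat b + toRat p / toRat q = toRat (a * q + b * p) / toRat (b * q) := by
    simp only [toRat, map_add, map_mul] at *
    field_simp
  rw [this, ratPderiv_div _ _ _ hb, ratPderiv_div _ _ _ hq, ratPderiv_div _ _ _ (mul_ne_zero hb hq)]
  simp only [toRat, Derivation.leibniz, smul_eq_mul, map_add, map_mul] at *
  field_simp
  ring

theorem ratPderiv_mul (i : Fin d) (f h : RatFun d) :
    ratPderiv i (f * h) = f * ratPderiv i h + h * ratPderiv i f := by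
  obtain ⟨a, b, hb, rfl⟩ := exists_eq_toRat_div f
  obtain ⟨p, q, hq, rfl⟩ := exists_eq_toRat_div h
  have hB := toRat_ne_zero hb
  have hQ := toRat_ne_zero hq
  have : toRat a / toRat b * (toRat p / toRat q) = toRat (a * p) / toRat (b * q) := by
    simp only [toRat, map_mul] at *
    field_simp
  rw [this, ratPderiv_div _ _ _ hb, ratPderiv_div _ _ _ hq, ratPderiv_div _ _ _ (mul_ne_zero hb hq)]
  simp only [toRat, Derivation.leibniz, smul_eq_mul, map_add, map_mul] at *
  field_simp
  ring

/-- The partial derivative of rational functions as a derivation. -/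
def ratDeriv (i : Fin d) := derivationOfLeibniz (AddMonoidHom.mk' (ratPderiv i) (ratPderiv_add i))
  (ratPderiv_mul i)

@[simp]
theorem ratDeriv_apply (i : Fin d) (f : RatFun d) : ratDeriv i f = ratPderiv i f := rfl

theorem ratDeriv_toRat (i : Fin d) (p : MvPolynomial (Fin d) ℂ) :
    ratDeriv i (toRat p) = toRat (pderiv i p) := ratPderiv_toRat i p

/-- The commutator is a derivation that kills polynomials; applied to b f = a it gives b [∂ᵢ, ∂ⱼ]f =
0. -/
theorem ratDeriv_comm (i j : Fin d) (f : RatFun d) :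
    ratDeriv i (ratDeriv j f) = ratDeriv j (ratDeriv i f) := by
  obtain ⟨a, b, hb, hf⟩ := exists_eq_toRat_div f
  have hB := toRat_ne_zero hb
  have h : toRat b * f = toRat a := by rw [hf]; field_simp
  have h1 := congrArg (fun x => ratDeriv i (ratDeriv j x) - ratDeriv j (ratDeriv i x)) h
  simp only [Derivation.leibniz, smul_eq_mul, map_add, ratDeriv_toRat] at h1
  rw [pderiv_comm i j a, pderiv_comm i j b, sub_self] at h1
  have h2 : toRat b * (ratDeriv i (ratDeriv j f) - ratDeriv j (ratDeriv i f)) = 0 := by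
    linear_combination h1
  exact sub_eq_zero.mp ((mul_eq_zero.mp h2).resolve_left hB)

end RatDeriv

/-! ### The Ricci tensor of an admissible cometric -/

section Ricci

variable {d : ℕ} {g : PolyTensor d}

/-- The matrices `(ωₛ)ᵗₖ = Γᵗₛₖ` of the Levi-Civita connection. -/
def connection (g : PolyTensor d) (s : Fin d) : Matrix (Fin d) (Fin d) (RatFun d) :=
  of fun t k => christoffel g t s k

theorem IsAdmissible.det_cometric_ne_zero (hg : IsAdmissible g) : (cometric g).det ≠ 0 := by
  have : (cometric g).det = toRat g.det := (RingHom.map_det _ g).symm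
  rw [this]
  exact toRat_ne_zero hg.det_ne_zero

theorem IsAdmissible.metric_mul_cometric (hg : IsAdmissible g) : metric g * cometric g = 1 :=
  nonsing_inv_mul _ (isUnit_iff_ne_zero.mpr hg.det_cometric_ne_zero)

theorem IsAdmissible.isSymm_cometric (hg : IsAdmissible g) : (cometric g).IsSymm :=
  hg.symm.map _

theorem IsAdmissible.isSymm_metric (hg : IsAdmissible g) : (metric g).IsSymm := by
  rw [IsSymm, metric, transpose_nonsing_inv, hg.isSymm_cometric.eq]

theorem IsAdmissible.christoffel_comm (hg : IsAdmissible g) (k i j : Fin d) :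
    christoffel g k i j = christoffel g k j i := by
  unfold christoffel
  refine congrArg (1 / 2 * ·) (Finset.sum_congr rfl fun s _ => ?_)
  rw [hg.isSymm_metric.apply j i, add_comm (ratPderiv i _)]

theorem connection_apply (g : PolyTensor d) (s t k : Fin d) :
    connection g s t k = 1 / 2 * ∑ r, cometric g t r * (ratDeriv s (metric g k r)
      + ratDeriv k (metric g s r) - ratDeriv r (metric g s k)) := rfl

theorem IsAdmissible.map_cometric (hg : IsAdmissible g) (s : Fin d) :
    (cometric g).map (ratDeriv s) =
      -(connection g s * cometric g + cometric g * (connection g s)ᵀ) :=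
  map_derivation_eq_neg (δ := ratDeriv) hg.isSymm_cometric hg.isSymm_metric hg.metric_mul_cometric
    (connection_apply g) s

theorem IsAdmissible.ricci_eq_sum_curvature (hg : IsAdmissible g) (k l : Fin d) :
    ricci g k l = ∑ s, curvature ratDeriv (connection g) s l s k := by
  rw [ricci, ← Finset.sum_add_distrib]
  refine Finset.sum_congr rfl fun s _ => ?_
  simp only [curvature, Matrix.add_apply, Matrix.sub_apply, mul_apply, connection, of_apply,
    map_apply, ratDeriv_apply, Finset.sum_sub_distrib]
  simp only [hg.christoffel_comm _ k]

/-- The only term whose symmetry is not formal is ∂ₗ ∑ₛ Γˢₖₛ; it is symmetric because tr ω is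
closed. -/
theorem IsAdmissible.ricci_comm (hg : IsAdmissible g) (k l : Fin d) :
    ricci g k l = ricci g l k := by
  have h := derivation_trace_comm (δ := ratDeriv) ratDeriv_comm
    (mul_eq_one_comm.mp hg.metric_mul_cometric) hg.map_cometric k l
  simp only [trace, diag_apply, connection, of_apply, map_sum, ratDeriv_apply] at h
  rw [ricci, ricci, Finset.sum_sub_distrib, Finset.sum_sub_distrib, h]
  simp only [Finset.sum_sub_distrib]
  rw [Finset.sum_comm (f := fun s t => christoffel g s l t * christoffel g t k s)]
  simp only [hg.christoffel_comm _ k l, mul_comm]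

theorem IsAdmissible.contraRicci_comm (hg : IsAdmissible g) (i j : Fin d) :
    contraRicci g i j = contraRicci g j i := by
  rw [contraRicci, contraRicci, Finset.sum_comm]
  refine Finset.sum_congr rfl fun l _ => Finset.sum_congr rfl fun k _ => ?_
  rw [hg.ricci_comm]
  ring

/-- The contravariant Ricci tensor as a contraction of the curvature with raised indices. -/
theorem IsAdmissible.contraRicci_eq (hg : IsAdmissible g) (p j : Fin d) :
    contraRicci g p j = -∑ q, (∑ s, ∑ l, (cometric g q s * cometric g j l) •
      curvature ratDeriv (connection g) s l) p q := by
  simp only [contraRicci, hg.ricci_eq_sum_curvature]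
  exact sum_contraction_eq_neg hg.isSymm_cometric
    (curvature_mul_add_mul_transpose (δ := ratDeriv) ratDeriv_comm hg.map_cometric) p j

/-- The curvature with both form indices raised is polynomial, of degree at most `2`. -/
theorem IsAdmissible.exists_polynomial_curvature (hg : IsAdmissible g) :
    ∃ R : Fin d → Fin d → PolyTensor d,
      (∀ i j, ∑ s, ∑ l, (cometric g i s * cometric g j l) •
        curvature ratDeriv (connection g) s l = (R i j).map toRat) ∧
      ∀ i j p q, (R i j p q).totalDegree ≤ 2 := by
  obtain ⟨c, hc, hcdeg⟩ := hg.exists_structure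
  -- In the Koszul formula the bracket is `g` applied to c, so the inverse metric in front of it
  -- cancels and only this polynomial expression remains.
  let A : Fin d → PolyTensor d := fun i => of fun t k =>
    C (-(1 / 2)) * (pderiv k (g i t) + c i t k)
  have hAdeg : ∀ i t k, (A i t k).totalDegree ≤ 1 := by
    intro i t k
    refine (totalDegree_mul _ _).trans ?_
    rw [totalDegree_C, zero_add]
    exact (totalDegree_add _ _).trans
      (max_le (totalDegree_pderiv_le k (hg.degree_le i t)) (hcdeg i t k))
  have hc' : ∀ i j l, ∑ k, cometric g l k * toRat (c i j k) =
      ∑ s, (cometric g i s * ratDeriv s (cometric g j l)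
        - cometric g j s * ratDeriv s (cometric g i l)) := by
    intro i j l
    have h := congrArg toRat (hc i j l)
    simp only [bracket, toRat, map_sum, map_sub, map_mul] at h
    simp only [cometric, map_apply, ratDeriv_toRat, toRat]
    exact h
  have hA : ∀ i, (A i).map toRat = ∑ s, cometric g i s • connection g s := by
    intro i
    ext t k
    rw [Matrix.sum_apply]
    have h := sum_mul_levi_civita (δ := ratDeriv) hg.isSymm_cometric hg.isSymm_metric
      hg.metric_mul_cometric i t k
    have hck : ∑ l, metric g k l * ∑ m, cometric g l m * toRat (c i t m) = toRat (c i t k) := by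
      have : metric g *ᵥ (cometric g *ᵥ fun m => toRat (c i t m)) = fun m => toRat (c i t m) := by
        rw [mulVec_mulVec, hg.metric_mul_cometric, one_mulVec]
      exact congrFun this k
    simp only [← hc', hck] at h
    simp only [Matrix.smul_apply, smul_eq_mul, map_apply, A, of_apply, connection]
    refine Eq.trans ?_ h.symm
    have hC : toRat (C (-(1 / 2)) : MvPolynomial (Fin d) ℂ) = -(1 / 2) := by
      have h2 : (C (-(1 / 2)) + C (-(1 / 2)) : MvPolynomial (Fin d) ℂ) = -1 := by
        rw [← C_add, ← C_1, ← C_neg]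
        norm_num
      have h3 := congrArg toRat h2
      simp only [toRat, map_add, map_one, map_neg] at h3 ⊢
      linear_combination h3 / 2
    simp only [toRat, map_mul, map_add] at hC ⊢
    rw [hC, cometric, map_apply, ratDeriv_toRat]
  refine ⟨fun i j => ∑ s, (g i s • (A j).map (pderiv s) - g j s • (A i).map (pderiv s))
    - ∑ k, c i j k • A k + (A i * A j - A j * A i), fun i j => ?_, fun i j p q => ?_⟩
  · rw [sum_smul_curvature (δ := ratDeriv) (c := fun i j k => toRat (c i j k)) hA hc'
      hg.isSymm_cometric]
    ext p q
    simp only [Matrix.add_apply, Matrix.sub_apply, Matrix.sum_apply, Matrix.smul_apply, map_apply,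
      mul_apply, smul_eq_mul, ratDeriv_toRat, cometric, toRat, map_add, map_sub, map_sum, map_mul]
  · have h1 : ∀ i j p q s, (g i s * pderiv s (A j p q)).totalDegree ≤ 2 := fun i j p q s =>
      (totalDegree_mul _ _).trans <| by
        have h1 := hg.degree_le i s
        have h2 := totalDegree_pderiv_le (n := 0) s (hAdeg j p q)
        omega
    have h2 : ∀ k, (c i j k * A k p q).totalDegree ≤ 2 := fun k =>
      (totalDegree_mul _ _).trans (Nat.add_le_add (hcdeg i j k) (hAdeg k p q))
    have h3 : ∀ i j p q k, (A i p k * A j k q).totalDegree ≤ 2 := fun i j p q k =>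
      (totalDegree_mul _ _).trans (Nat.add_le_add (hAdeg i p k) (hAdeg j k q))
    simp only [Matrix.add_apply, Matrix.sub_apply, Matrix.sum_apply, Matrix.smul_apply, map_apply,
      mul_apply, smul_eq_mul]
    refine (totalDegree_add _ _).trans (max_le ((totalDegree_sub _ _).trans (max_le ?_ ?_))
      ((totalDegree_sub _ _).trans (max_le ?_ ?_)))
    · exact totalDegree_finsetSum_le fun s _ =>
        (totalDegree_sub _ _).trans (max_le (h1 i j p q s) (h1 j i p q s))
    · exact totalDegree_finsetSum_le fun k _ => h2 k
    · exact totalDegree_finsetSum_le fun k _ => h3 i j p q k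
    · exact totalDegree_finsetSum_le fun k _ => h3 j i p q k

theorem map_toRat_injective :
    Function.Injective fun M : PolyTensor d => (M.map toRat : Matrix _ _ (RatFun d)) :=
  Matrix.map_injective toRat_injective

/-- If `R` is skew with respect to an admissible cometric `g`, then `dD` contracted with the first
index of `R` is divisible by `D`. -/
theorem IsAdmissible.dvd_sum_of_skew (hg : IsAdmissible g) {R : PolyTensor d}
    (hR : R * g + g * Rᵀ = 0) (i : Fin d) : g.det ∣ ∑ p, R p i * pderiv p g.det := by
  choose a ha using hg.det_dvd
  let N : Fin d → MvPolynomial (Fin d) ℂ := fun l => pderiv l g.det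
  have hN : g *ᵥ N = g.det • a := funext ha
  have hR' : g * Rᵀ = -(R * g) := eq_neg_of_add_eq_zero_right hR
  have hskew : N ⬝ᵥ ((R * g) *ᵥ N) = 0 := by
    have h1 : N ⬝ᵥ ((R * g) *ᵥ N) = N ⬝ᵥ ((g * Rᵀ) *ᵥ N) := by
      have : (g * Rᵀ) = (R * g)ᵀ := by rw [transpose_mul, hg.symm.eq]
      rw [this, mulVec_transpose, dotProduct_comm N (N ᵥ* _), ← dotProduct_mulVec]
    rw [hR', neg_mulVec, dotProduct_neg] at h1
    exact self_eq_neg.mp h1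
  -- Since R g is skew and g N = D a, 0 = N · R g N = D (N · R a). So the field R a annihilates D;
  -- it is logarithmic and equals g W.
  have hlog : IsLog g.det (R *ᵥ a) := by
    rw [← mulVec_mulVec, hN, mulVec_smul, dotProduct_smul, smul_eq_mul] at hskew
    have h0 := (mul_eq_zero.mp hskew).resolve_left hg.det_ne_zero
    have : ∑ j, (R *ᵥ a) j * pderiv j g.det = 0 := by
      rw [dotProduct_comm] at h0
      exact h0
    rw [IsLog, this]
    exact dvd_zero _
  obtain ⟨W, hW, -⟩ := hg.exists_mulVec_eq hlog
  -- g Rᵀ N = -R g N = -D R a = -g (D W), and the injectivity of `g` allows it to be cancelled.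
  have h2 : g *ᵥ (Rᵀ *ᵥ N) = g *ᵥ (-(g.det • W)) := by
    rw [mulVec_mulVec, hR', neg_mulVec, ← mulVec_mulVec, hN, mulVec_smul, mulVec_neg, mulVec_smul,
      hW]
  have h3 : Rᵀ *ᵥ N = -(g.det • W) := by
    have hz : g *ᵥ (Rᵀ *ᵥ N - -(g.det • W)) = 0 := by rw [mulVec_sub, h2, sub_self]
    exact sub_eq_zero.mp (eq_zero_of_mulVec_eq_zero hg.det_ne_zero hz)
  have h4 : ∑ p, R p i * pderiv p g.det = g.det * -W i := by
    have := congrFun h3 i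
    simpa [mulVec, dotProduct, N] using this
  exact h4 ▸ dvd_mul_right _ _

/-- The contravariant Ricci tensor of an admissible cometric is polynomial of degree at most `2`,
and it is tangent to the branch divisor. -/
theorem IsAdmissible.exists_polynomial_contraRicci (hg : IsAdmissible g) :
    ∃ h : PolyTensor d, h.IsSymm ∧ (∀ i j, (h i j).totalDegree ≤ 2) ∧
      (∀ i, g.det ∣ ∑ j, h i j * pderiv j g.det) ∧ ∀ i j, contraRicci g i j = toRat (h i j) := by
  obtain ⟨R, hR, hdeg⟩ := hg.exists_polynomial_curvature
  let h : PolyTensor d := of fun p j => -∑ q, R q j p q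
  have hh : ∀ i j, contraRicci g i j = toRat (h i j) := by
    intro i j
    simp only [hg.contraRicci_eq, hR, map_apply, h, of_apply, toRat, map_neg, map_sum]
  have hsymm : h.IsSymm := by
    refine Matrix.ext fun i j => toRat_injective ?_
    rw [transpose_apply, ← hh, ← hh, hg.contraRicci_comm]
  refine ⟨h, hsymm, fun i j => ?_, fun i => ?_, hh⟩
  · simp only [h, of_apply, totalDegree_neg]
    exact totalDegree_finsetSum_le fun q _ => hdeg q j i q
  · have hskew : ∀ q, R q i * g + g * (R q i)ᵀ = 0 := by
      intro q
      apply map_toRat_injective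
      have hsum : (R q i).map toRat * cometric g + cometric g * ((R q i).map toRat)ᵀ = 0 := by
        rw [← hR]
        exact sum_smul_mul_add_mul_transpose
          (curvature_mul_add_mul_transpose (δ := ratDeriv) ratDeriv_comm hg.map_cometric) _
      ext p r
      have := congrFun (congrFun hsum p) r
      simpa [mul_apply, cometric, toRat] using this
    have hsum : ∑ j, h i j * pderiv j g.det = -∑ q, ∑ p, R q i p q * pderiv p g.det := by
      rw [Finset.sum_comm, ← Finset.sum_neg_distrib]
      refine Finset.sum_congr rfl fun p _ => ?_
      -- Symmetry of h makes dD contract with the upper matrix index of R, where `dvd_sum_of_skew`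
      -- applies.
      rw [← hsymm.apply i p, ← Finset.sum_mul, ← neg_mul]
      rfl
    rw [hsum, dvd_neg]
    exact Finset.dvd_sum fun q _ => hg.dvd_sum_of_skew (hskew q) q

end Ricci

/-! ### Tensors tangent to the branch divisor come from the double covering -/

section Cover

variable {d : ℕ} {D : MvPolynomial (Fin d) ℂ}

theorem eval_rename_some (p : Pt d) (q : MvPolynomial (Fin d) ℂ) :
    eval p (rename some q) = eval (proj p) q := by
  rw [eval_rename]
  rfl

theorem eval_pderiv_some_coverEq (p : Pt d) (j : Fin d) :
    eval p (pderiv (some j) (coverEq D)) = -eval (proj p) (pderiv j D) := by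
  rw [coverEq, map_sub, pderiv_rename (Option.some_injective _), map_sub, eval_rename_some,
    pderiv_pow, pderiv_X_of_ne (by simp)]
  simp

theorem eval_pderiv_none_coverEq (p : Pt d) :
    eval p (pderiv none (coverEq D)) = 2 * p none := by
  classical
  have : pderiv none (rename some D : MvPolynomial (Option (Fin d)) ℂ) = 0 := by
    refine pderiv_eq_zero_of_notMem_vars fun h => ?_
    simpa using vars_rename some D h
  rw [coverEq, map_sub, this, pderiv_pow, pderiv_X_self]
  simp

/-- On the cover dy = dD / (2y), which forces the y-components of a lift. With ∑ⱼ hⁱʲ ∂ⱼD = D bᵢ and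
y² = D, they are y bᵢ / 2 and ∑ᵢ bᵢ ∂ᵢD / 4, without denominators in x and y. -/
theorem comesFromDoubleCover_of_dvd {h : PolyTensor d} (hs : h.IsSymm)
    (hD : ∀ i, D ∣ ∑ j, h i j * pderiv j D) : ComesFromDoubleCover D h := by
  choose b hb using hD
  let N : Option (Fin d) → Option (Fin d) → MvPolynomial (Option (Fin d)) ℂ
    | some i, some j => rename some (h i j)
    | some i, none => C (1 / 2) * X none * rename some (b i)
    | none, some i => C (1 / 2) * X none * rename some (b i)
    | none, none => C (1 / 4) * rename some (∑ i, b i * pderiv i D)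
  have hproj : ∀ p : Pt d, proj (involution p) = proj p := fun p => rfl
  refine ⟨fun a c p => eval p (N a c), ⟨fun a c p _ => ⟨N a c, 1, by simp, by simp⟩, ?_, ?_, ?_⟩,
    fun i j p _ => eval_rename_some p _⟩
  · rintro (_ | i) (_ | j) p - <;> simp only [N]
    rw [hs.apply i j]
  · rintro (_ | i) p ⟨hp, -⟩
    · simp only [Fintype.sum_option, N, eval_pderiv_none_coverEq, eval_pderiv_some_coverEq,
        map_mul, eval_rename_some, eval_C, eval_X, map_sum, mul_neg, Finset.sum_neg_distrib,
        Finset.sum_mul, Finset.mul_sum]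
      rw [← sub_eq_add_neg, ← Finset.sum_sub_distrib]
      refine Finset.sum_eq_zero fun i _ => ?_
      ring
    · have h1 := congrArg (eval (proj p)) (hb i)
      simp only [map_sum, map_mul] at h1
      simp only [coverEq, map_sub, map_pow, eval_X, eval_rename_some] at hp
      simp only [Fintype.sum_option, N, eval_pderiv_none_coverEq, eval_pderiv_some_coverEq,
        map_mul, eval_rename_some, eval_C, eval_X, mul_neg, Finset.sum_neg_distrib]
      rw [h1]
      linear_combination eval (proj p) (b i) * hp
  · rintro (_ | i) (_ | j) p - <;>
    simp [N, eval_rename_some, hproj, involutionSign, involution]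

end Cover

end PolyCometric

end

theorem theorem3p6 (d : ℕ) (g : PolyCometric.PolyTensor d)
    (hadm : PolyCometric.IsAdmissible g) (hirr : PolyCometric.IsIrreducible g) :
    ∃ c : ℂ, ∀ i j : Fin d,
      PolyCometric.contraRicci g i j = c • PolyCometric.cometric g i j := by
  obtain ⟨h, hsymm, hdeg, hdvd, hh⟩ := hadm.exists_polynomial_contraRicci
  obtain ⟨c, rfl⟩ := hirr h hsymm hdeg (PolyCometric.comesFromDoubleCover_of_dvd hsymm hdvd)
  refine ⟨c, fun i j => ?_⟩
  rw [hh, Matrix.smul_apply]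
  exact algebraMap.coe_smul c (g i j) (PolyCometric.RatFun d)
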